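/- Let $n,m_1,m_2\ge 0$ be integers. For $u,v\in\mathbb{R}^n$ let $u\circledast v\in\mathbb{R}^n$ be their circular convolution, $(u\circledast v)_k=\sum_{j} u_j v_{k-j}$ with indices taken modulo $n$, and let $\|x\|_0$ be the number of nonzero entries of $x$. Consider one of the following three scenarios, where $s_1,s_2\ge 0$ are integers: - (subspace constraints) $\Omega_X=\mathbb{R}^{m_1}$, $\Omega_Y=\mathbb{R}^{m_2}$, $d=m_1+m_2$; - (mixed constraints) $\Omega_X=\{x\in\mathbb{R}^{m_1}:\|x\|_0\le s_1\}$, $\Omega_Y=\mathbb{R}^{m_2}$, $d=s_1+m_2$; - (sparsity constraints) $\Omega_X=\{x\in\mathbb{R}^{m_1}:\|x\|_0\le s_1\}$, $\Omega_Y=\{y\in\mathbb{R}^{m_2}:\|y\|_0\le s_2\}$, $d=s_1+s_2$. Given $D\in\mathbb{R}^{n\times m_1}$ and $E\in\mathbb{R}^{n\times m_2}$, a pair $(x_0,y_0)\in\Omega_X\times\Omega_Y$ with $x_0\ne 0$ and $y_0\ne 0$ is called identifiable up to scaling if every $(x,y)\in\Omega_X\times\Omega_Y$ with $(Dx)\circledast(Ey)=(Dx_0)\circledast(Ey_0)$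 satisfies $x=\sigma x_0$ and $y=\frac{1}{\sigma}y_0$ for some nonzero $\sigma\in\mathbb{R}$. "Almost all" $(D,E)$ means all but a set of Lebesgue measure zero in $\mathbb{R}^{n\times m_1}\times\mathbb{R}^{n\times m_2}$. **Theorem.** In each of the three scenarios: 1. (Weak identifiability) If $n>d$, then for every fixed pair $(x_0,y_0)\in\Omega_X\times\Omega_Y$ with $x_0\neq0$ and $y_0\neq0$, for almost all $D\in\mathbb{R}^{n\times m_1}$ and $E\in\mathbb{R}^{n\times m_2}$ the pair $(x_0,y_0)$ is identifiable up to scaling. 2. (Strong identifiability) If $n>2d$, then for almost all $D\in\mathbb{R}^{n\times m_1}$ and $E\in\mathbb{R}^{n\times m_2}$, all pairs $(x_0,y_0)\in\Omega_X\times\Omega_Y$ with $x_0\neq0$ and $y_0\neq0$ are identifiable up to scaling. -/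

import Mathlib

open MeasureTheory

namespace BlindDeconv

/-- Circular convolution of two real vectors of length `n`:
`(u ⊛ v) k = ∑ j, u j * v (k - j)`, with indices modulo `n`. -/
def circConv {n : ℕ} (u v : Fin n → ℝ) : Fin n → ℝ :=
  fun k => ∑ j, u j * v (k - j)

/-- The vectors in `ℝ^m` with at most `s` nonzero entries. -/
def sparseVectors (m s : ℕ) : Set (Fin m → ℝ) :=
  {x | hammingNorm x ≤ s}

/-- The three kinds of constraints on the pair of unknown coefficient vectors `(x, y)`. -/
inductive Scenario : Type
  /-- both signal and filter are constrained to subspaces -/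
  | subspace
  /-- the signal is `s₁`-sparse over a dictionary, the filter lies in a subspace -/
  | mixed (s₁ : ℕ)
  /-- signal and filter are `s₁`-sparse and `s₂`-sparse over dictionaries -/
  | sparsity (s₁ s₂ : ℕ)

/-- The constraint set for `x ∈ ℝ^m₁`. -/
def Scenario.setX (m₁ : ℕ) : Scenario → Set (Fin m₁ → ℝ)
  | .subspace => Set.univ
  | .mixed s₁ => sparseVectors m₁ s₁
  | .sparsity s₁ _ => sparseVectors m₁ s₁

/-- The constraint set for `y ∈ ℝ^m₂`. -/
def Scenario.setY (m₂ : ℕ) : Scenario → Set (Fin m₂ → ℝ)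
  | .subspace => Set.univ
  | .mixed _ => Set.univ
  | .sparsity _ s₂ => sparseVectors m₂ s₂

/-- The sample complexity bound `d`. -/
def Scenario.d (m₁ m₂ : ℕ) : Scenario → ℕ
  | .subspace => m₁ + m₂
  | .mixed s₁ => s₁ + m₂
  | .sparsity s₁ s₂ => s₁ + s₂

/-- The pair `(x₀, y₀)` is identifiable up to scaling: every `(x, y) ∈ X × Y` with
`(D x) ⊛ (E y) = (D x₀) ⊛ (E y₀)` is of the form `(σ x₀, σ⁻¹ y₀)` with `σ ≠ 0`. -/
def PairIdentifiable {n m₁ m₂ : ℕ} (D : Matrix (Fin n) (Fin m₁) ℝ)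
    (E : Matrix (Fin n) (Fin m₂) ℝ) (X : Set (Fin m₁ → ℝ)) (Y : Set (Fin m₂ → ℝ))
    (x₀ : Fin m₁ → ℝ) (y₀ : Fin m₂ → ℝ) : Prop :=
  ∀ x ∈ X, ∀ y ∈ Y,
    circConv (D.mulVec x) (E.mulVec y) = circConv (D.mulVec x₀) (E.mulVec y₀) →
      ∃ σ : ℝ, σ ≠ 0 ∧ x = σ • x₀ ∧ y = σ⁻¹ • y₀

/-- The set `X × Y` is identifiable up to scaling: every pair in it with both components
nonzero is. -/
def SetIdentifiable {n m₁ m₂ : ℕ} (D : Matrix (Fin n) (Fin m₁) ℝ)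
    (E : Matrix (Fin n) (Fin m₂) ℝ) (X : Set (Fin m₁ → ℝ)) (Y : Set (Fin m₂ → ℝ)) : Prop :=
  ∀ x₀ ∈ X, ∀ y₀ ∈ Y, x₀ ≠ 0 → y₀ ≠ 0 → PairIdentifiable D E X Y x₀ y₀

end BlindDeconv

/-! Two pairs with the same measurement have a matrix `M = x yᵀ - x₀ y₀ᵀ` annihilated by the
bilinear form `∑ i, D i * ∑ j, M i j • E j`, where columns are read in the algebra of circular
convolution. It suffices that almost no `(D, E)` annihilates a nonzero `M` from a family with fewer
than `n` parameters: equal outer products force equality up to scaling (`exists_smul_of_mul_eq`).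

The real DFT turns convolution into a pointwise product, so each element has a support idempotent
`e` (`exists_support_idempotent`). Fix `M i j ≠ 0` and let `e` be the support of `w = ∑ j, M i j • E
j`. Off `e`, the equation `w = 0` determines `(1 - e) * E j`; on `e`, `w` is invertible and the
bilinear equation determines `e * D i`. Together these remove exactly `n` real dimensions, while `M`
contributes fewer than `n`. The bad set is thus a finite union of differentiable images of
lower-dimensional sets, hence null (`addHaar_image_bilinear_zero_set`). -/

namespace BlindDeconv

/-! ### Null images by dimension count -/

/-- The image of a set contained in a subspace of smaller dimension than the target, under a map
differentiable on that set, is a null set. -/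
lemma addHaar_image_eq_zero_of_finrank_lt {U G : Type*}
    [NormedAddCommGroup U] [NormedSpace ℝ U] [FiniteDimensional ℝ U]
    [NormedAddCommGroup G] [NormedSpace ℝ G] [FiniteDimensional ℝ G]
    [MeasurableSpace G] [BorelSpace G] (μ : Measure G) [μ.IsAddHaarMeasure]
    (K : Submodule ℝ U) (hK : Module.finrank ℝ K < Module.finrank ℝ G)
    {f : U → G} {s : Set U} (hs : s ⊆ K) (hf : DifferentiableOn ℝ f s) :
    μ (f '' s) = 0 := by
  -- Differentiable self-maps of `G` preserve null sets, so `K` is realised as a proper, hence null,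
  -- subspace of `G`, and `f` is precomposed with a left inverse of the embedding.
  obtain ⟨ι, hι⟩ : ∃ ι : K →ₗ[ℝ] G, Function.Injective ι :=
    lift_rank_le_iff_exists_linearMap.mp
      (by simpa only [← Module.finrank_eq_rank, Cardinal.lift_natCast, Nat.cast_le] using hK.le)
  obtain ⟨π, hπ⟩ := ι.exists_leftInverse_of_injective (LinearMap.ker_eq_bot.mpr hι)
  have hπ' (k : K) : π (ι k) = k := LinearMap.congr_fun hπ k
  let p : G →L[ℝ] U := LinearMap.toContinuousLinearMap (K.subtype ∘ₗ π)
  have hp (k : K) : p (ι k) = k := by simp [p, hπ']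
  let t : Set G := (LinearMap.range ι : Set G) ∩ p ⁻¹' s
  have hsub : f '' s ⊆ (f ∘ p) '' t := by
    rintro _ ⟨u, hu, rfl⟩
    refine ⟨ι ⟨u, hs hu⟩, ⟨⟨_, rfl⟩, ?_⟩, ?_⟩
    · simpa [hp] using hu
    · simp [hp]
  refine measure_mono_null hsub
    (addHaar_image_eq_zero_of_differentiableOn_of_addHaar_eq_zero μ
      (hf.comp p.differentiable.differentiableOn fun z hz => hz.2) ?_)
  refine measure_mono_null Set.inter_subset_left (Measure.addHaar_submodule μ _ fun htop => ?_)
  have h1 := LinearMap.finrank_range_of_inj hι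
  rw [htop, finrank_top] at h1
  omega

/-! ### Annihilators of bilinear forms over an algebra -/

section Bilinear

variable {A : Type*} [NormedCommRing A] [NormedAlgebra ℝ A]
  {ι κ : Type*} [Fintype κ]

/-- The coefficient of `D i` in `∑ i, ∑ j, M i j • (D i * E j)`. -/
def rowComb (M : ι → κ → ℝ) (E : κ → A) (i : ι) : A := ∑ j, M i j • E j

/-- With `c` in place of coordinate `j`, the value of `E j` for which
`(1 - e) * ∑ j, M i j • E j = 0` and `e * E j = e * c`. -/
noncomputable def solveE [DecidableEq κ] (e : A) (M : ι → κ → ℝ) (i : ι) (j : κ) (c : A) (E : κ → A) : κ → A :=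
  Function.update E j (e * c - (1 - e) * ((M i j)⁻¹ • rowComb M E i))

/-- The value of `D` with `∑ i, D i * rowComb M E i = 0` after multiplication by `e`, and with
`(1 - e) * D i` left unchanged. -/
noncomputable def solveD [Fintype ι] [DecidableEq ι] (e : A) (M : ι → κ → ℝ) (i : ι) (D : ι → A) (E : κ → A) : ι → A :=
  Function.update D i ((1 - e) * D i - Ring.inverse (rowComb M E i + (1 - e)) *
    (e * ∑ i', Function.update D i 0 i' * rowComb M E i'))

lemma rowComb_update_zero [DecidableEq κ] (M : ι → κ → ℝ) (E : κ → A) (i : ι) (j : κ) :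
    rowComb M (Function.update E j 0) i = rowComb M E i - M i j • E j := by
  rw [rowComb, rowComb, ← Finset.add_sum_erase _ _ (Finset.mem_univ j),
    ← Finset.add_sum_erase (a := j) _ (fun j => M i j • E j) (Finset.mem_univ j)]
  simp only [Function.update_self, smul_zero, zero_add, add_sub_cancel_left]
  exact Finset.sum_congr rfl fun k hk => by
    rw [Function.update_of_ne (Finset.ne_of_mem_erase hk)]

lemma sum_update_zero_mul {R ι : Type*} [CommRing R] [Fintype ι] [DecidableEq ι]
    (D w : ι → R) (i : ι) :
    ∑ i', Function.update D i 0 i' * w i' = ∑ i', D i' * w i' - D i * w i := by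
  rw [← Finset.add_sum_erase _ _ (Finset.mem_univ i),
    ← Finset.add_sum_erase (a := i) _ (fun i => D i * w i) (Finset.mem_univ i)]
  simp only [Function.update_self, zero_mul, zero_add, add_sub_cancel_left]
  exact Finset.sum_congr rfl fun k hk => by
    rw [Function.update_of_ne (Finset.ne_of_mem_erase hk)]

/-- By `hw` the component of `rowComb M E i` off `e` vanishes, so there the `j`-th term is minus the
sum of the others. The summand with `d` is killed by `e`, which leaves that slot free to store part
of `D i`. -/
lemma solveE_eq [DecidableEq κ] {e : A} (he : e * e = e) {M : ι → κ → ℝ} {i : ι} {j : κ} (hM : M i j ≠ 0)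
    (d : A) (E : κ → A) (hw : e * rowComb M E i = rowComb M E i) :
    solveE e M i j ((1 - e) * d + e * E j) (Function.update E j 0) = E := by
  have h : (1 - e) * ((M i j)⁻¹ • rowComb M (Function.update E j 0) i) = - ((1 - e) * E j) := by
    rw [rowComb_update_zero, smul_sub, inv_smul_smul₀ hM, mul_sub, mul_smul_comm, sub_mul 1, hw]
    simp
  rw [solveE, h, Function.update_idem]
  convert Function.update_eq_self j E using 2
  linear_combination (E j - d) * he

/-- Multiplication by `rowComb M E i` agrees with multiplication by the unit `rowComb M E i + (1 -
e)` on multiples of `e`, so `h0` can be solved for `e * D i`. -/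
lemma solveD_eq [Fintype ι] [DecidableEq ι] {e : A} (he : e * e = e) {M : ι → κ → ℝ} {i : ι} (c : A) (D : ι → A)
    (E : κ → A) (hu : IsUnit (rowComb M E i + (1 - e))) (h0 : ∑ i', D i' * rowComb M E i' = 0) :
    solveD e M i (Function.update D i ((1 - e) * D i + e * c)) E = D := by
  rw [solveD, Function.update_idem, Function.update_idem, Function.update_self,
    sum_update_zero_mul, h0]
  have h : Ring.inverse (rowComb M E i + (1 - e)) * (e * (0 - D i * rowComb M E i)) =
      - (e * D i) := by
    have : e * (0 - D i * rowComb M E i) = (rowComb M E i + (1 - e)) * (- (e * D i)) := by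
      linear_combination (-D i) * he
    rw [this, Ring.inverse_mul_cancel_left _ _ hu]
  rw [h]
  convert Function.update_eq_self i D using 2
  linear_combination (D i - c) * he


lemma differentiableAt_rowComb {U : Type*} [NormedAddCommGroup U] [NormedSpace ℝ U]
    {M : U → ι → κ → ℝ} {E : U → κ → A} {u : U} (hM : ∀ i j, DifferentiableAt ℝ (fun u => M u i j) u)
    (hE : DifferentiableAt ℝ E u) (i : ι) :
    DifferentiableAt ℝ (fun u => rowComb (M u) (E u) i) u := by
  have h := differentiableAt_pi.mp hE
  unfold rowComb
  exact DifferentiableAt.fun_sum fun j _ => (hM i j).smul (h j)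

lemma differentiableAt_update {ι U : Type*} [Fintype ι] [NormedAddCommGroup U] [NormedSpace ℝ U]
    [DecidableEq ι] {D : U → ι → A} {c : U → A} {u : U} (hD : DifferentiableAt ℝ D u)
    (hc : DifferentiableAt ℝ c u) (i : ι) :
    DifferentiableAt ℝ (fun u => Function.update (D u) i (c u)) u := by
  refine differentiableAt_pi.mpr fun k => ?_
  rcases eq_or_ne k i with rfl | hk
  · simpa using hc
  · simpa [Function.update_of_ne hk] using differentiableAt_pi.mp hD k

lemma differentiableAt_solveE {U : Type*} [NormedAddCommGroup U] [NormedSpace ℝ U]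
    [DecidableEq κ] (e : A)
    {M : U → ι → κ → ℝ} {c : U → A} {E : U → κ → A} {u : U}
    (hM : ∀ i j, DifferentiableAt ℝ (fun u => M u i j) u)
    (hc : DifferentiableAt ℝ c u) (hE : DifferentiableAt ℝ E u) {i : ι} {j : κ}
    (h0 : M u i j ≠ 0) :
    DifferentiableAt ℝ (fun u => solveE e (M u) i j (c u) (E u)) u :=
  differentiableAt_update hE (((differentiableAt_const e).mul hc).sub
    ((differentiableAt_const _).mul (((hM i j).inv h0).smul (differentiableAt_rowComb hM hE i)))) j

lemma differentiableAt_solveD {U : Type*} [NormedAddCommGroup U] [NormedSpace ℝ U]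
    [CompleteSpace A] [Fintype ι] [DecidableEq ι] (e : A)
    {M : U → ι → κ → ℝ} {D : U → ι → A} {E : U → κ → A} {u : U}
    (hM : ∀ i j, DifferentiableAt ℝ (fun u => M u i j) u)
    (hD : DifferentiableAt ℝ D u) (hE : DifferentiableAt ℝ E u) {i : ι}
    (hu : IsUnit (rowComb (M u) (E u) i + (1 - e))) :
    DifferentiableAt ℝ (fun u => solveD e (M u) i (D u) (E u)) u := by
  refine differentiableAt_update hD (((differentiableAt_const _).mul
    (differentiableAt_pi.mp hD i)).sub (DifferentiableAt.mul ?_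
      ((differentiableAt_const e).mul ?_))) i
  · exact ((differentiableAt_rowComb hM hE i).add (differentiableAt_const _)).inverse hu
  · exact DifferentiableAt.fun_sum fun k _ =>
      (differentiableAt_pi.mp (differentiableAt_update hD (differentiableAt_const 0) i) k).mul
        (differentiableAt_rowComb hM hE k)

variable [Fintype ι] [FiniteDimensional ℝ A]
  {Q : Type*} [NormedAddCommGroup Q] [NormedSpace ℝ Q] [FiniteDimensional ℝ Q]
  {G : Type*} [NormedAddCommGroup G] [NormedSpace ℝ G] [FiniteDimensional ℝ G]
  [MeasurableSpace G] [BorelSpace G]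

/-- The part of the bad set in which `M q i j ≠ 0` and the support of `rowComb (M q) E i` is given
by the idempotent `e`. -/
lemma addHaar_image_bilinear_zero_set_aux (μ : Measure G) [μ.IsAddHaarMeasure]
    (L : (ι → A) × (κ → A) →ₗ[ℝ] G)
    (hG : Module.finrank ℝ G = Module.finrank ℝ ((ι → A) × (κ → A)))
    (hQ : Module.finrank ℝ Q < Module.finrank ℝ A)
    (M : Q → ι → κ → ℝ) (hM : ∀ i j, Differentiable ℝ fun q => M q i j)
    (i : ι) (j : κ) {e : A} (he : e * e = e) :
    μ (L '' {DE | ∃ q, M q i j ≠ 0 ∧ e * rowComb (M q) DE.2 i = rowComb (M q) DE.2 i ∧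
      IsUnit (rowComb (M q) DE.2 i + (1 - e)) ∧ ∑ i', DE.1 i' * rowComb (M q) DE.2 i' = 0}) = 0 := by
  classical
  have : CompleteSpace A := FiniteDimensional.complete ℝ A
  let U := Q × (ι → A) × (κ → A)
  let p : U →ₗ[ℝ] A := LinearMap.proj j ∘ₗ LinearMap.snd ℝ _ _ ∘ₗ LinearMap.snd ℝ _ _
  let gE : U → κ → A := fun u => solveE e (M u.1) i j (u.2.1 i) u.2.2
  let gD : U → ι → A := fun u => solveD e (M u.1) i u.2.1 (gE u)
  let L' : (ι → A) × (κ → A) →L[ℝ] G := LinearMap.toContinuousLinearMap L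
  let s : Set U := {u | u ∈ LinearMap.ker p ∧ M u.1 i j ≠ 0 ∧
    IsUnit (rowComb (M u.1) (gE u) i + (1 - e))}
  have hp : Function.Surjective p := fun a => ⟨(0, 0, fun _ => a), rfl⟩
  -- Setting slot `j` of `E` to zero costs `dim A`, more than the `dim Q` gained from the
  -- parameters.
  have hker : Module.finrank ℝ (LinearMap.ker p) < Module.finrank ℝ G := by
    have h1 := p.finrank_range_add_finrank_ker
    rw [LinearMap.range_eq_top.mpr hp, finrank_top] at h1
    have h2 : Module.finrank ℝ U = Module.finrank ℝ Q + Module.finrank ℝ ((ι → A) × (κ → A)) :=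
      Module.finrank_prod
    omega
  refine measure_mono_null ?_ (addHaar_image_eq_zero_of_finrank_lt μ (LinearMap.ker p) hker
    (f := fun u => L' (gD u, gE u)) (s := s) (fun u hu => hu.1) fun u hu => ?_)
  · rintro _ ⟨⟨D, E⟩, ⟨q, h0, hw, hu, hsum⟩, rfl⟩
    -- The undetermined parts of `D i` and `E j` lie in complementary ideals, so a single element of
    -- `A` holds both.
    let c := (1 - e) * D i + e * E j
    have hE : gE (q, Function.update D i c, Function.update E j 0) = E := by
      simpa [gE, c] using solveE_eq he h0 (D i) E hw
    have hD : gD (q, Function.update D i c, Function.update E j 0) = D := by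
      simpa [gD, hE, c] using solveD_eq he (E j) D E hu hsum
    refine ⟨(q, Function.update D i c, Function.update E j 0), ⟨?_, h0, ?_⟩, ?_⟩
    · exact Function.update_self j (0 : A) E
    · rwa [hE]
    · simp only [hD, hE]; rfl
  · have hM' (i j) : DifferentiableAt ℝ (fun u : U => M u.1 i j) u :=
      (hM i j _).comp u differentiableAt_fst
    have hE : DifferentiableAt ℝ gE u := differentiableAt_solveE e hM'
      (differentiableAt_pi.mp differentiableAt_snd.fst i) differentiableAt_snd.snd hu.2.1
    have hD : DifferentiableAt ℝ gD u := differentiableAt_solveD e hM' differentiableAt_snd.fst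
      hE hu.2.2
    exact (L'.differentiableAt.comp u (hD.prodMk hE)).differentiableWithinAt

/-- Let `A` be a finite-dimensional commutative algebra in which every element has its support
among finitely many idempotents. For a family of matrices `M q` with fewer than `dim A` parameters,
the pairs `(D, E)` annihilated by some nonzero `M q` form a null set. -/
theorem addHaar_image_bilinear_zero_set (μ : Measure G) [μ.IsAddHaarMeasure]
    (L : (ι → A) × (κ → A) →ₗ[ℝ] G)
    (hG : Module.finrank ℝ G = Module.finrank ℝ ((ι → A) × (κ → A)))
    (hQ : Module.finrank ℝ Q < Module.finrank ℝ A)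
    (M : Q → ι → κ → ℝ) (hM : ∀ i j, Differentiable ℝ fun q => M q i j)
    {I : Set A} (hI : I.Countable)
    (hA : ∀ w : A, ∃ e ∈ I, e * e = e ∧ e * w = w ∧ IsUnit (w + (1 - e))) :
    μ (L '' {DE | ∃ q, M q ≠ 0 ∧ ∑ i, DE.1 i * ∑ j, M q i j • DE.2 j = 0}) = 0 := by
  refine measure_mono_null (t := ⋃ i, ⋃ j, ⋃ e ∈ {e ∈ I | e * e = e},
    L '' {DE | ∃ q, M q i j ≠ 0 ∧ e * rowComb (M q) DE.2 i = rowComb (M q) DE.2 i ∧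
      IsUnit (rowComb (M q) DE.2 i + (1 - e)) ∧
        ∑ i', DE.1 i' * rowComb (M q) DE.2 i' = 0}) ?_ ?_
  · rintro _ ⟨DE, ⟨q, h0, hsum⟩, rfl⟩
    obtain ⟨i, hi⟩ := Function.ne_iff.mp h0
    obtain ⟨j, hj⟩ := Function.ne_iff.mp hi
    obtain ⟨e, heI, he, hw, hu⟩ := hA (rowComb (M q) DE.2 i)
    simp only [Set.mem_iUnion]
    exact ⟨i, j, e, ⟨heI, he⟩, DE, ⟨q, hj, hw, hu, hsum⟩, rfl⟩
  · simp only [measure_iUnion_null_iff]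
    exact fun i j => (measure_biUnion_null_iff (hI.mono (Set.sep_subset _ _))).mpr
      fun e he => addHaar_image_bilinear_zero_set_aux μ L hG hQ M hM i j he.2

end Bilinear

/-! ### Circular convolution as a pointwise product -/

section DFT

variable {n : ℕ} [NeZero n]

/-- The functions on `ℤ/n` that are discrete Fourier transforms of real functions. -/
def conjSymm (n : ℕ) : Subalgebra ℝ (ZMod n → ℂ) where
  carrier := {f | ∀ k, f (-k) = starRingEnd ℂ (f k)}
  mul_mem' ha hb k := by simp [ha k, hb k]
  add_mem' ha hb k := by simp [ha k, hb k]
  algebraMap_mem' r k := by simp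

/-- The `0`-`1`-valued elements of `conjSymm n`. -/
def indicators (n : ℕ) : Set (conjSymm n) := {e | ∀ k, e.1 k = 0 ∨ e.1 k = 1}

lemma finite_indicators : (indicators n).Finite := by
  have h : (Set.univ.pi fun _ : ZMod n => ({0, 1} : Set ℂ)).Finite :=
    Set.Finite.pi fun _ => Set.toFinite _
  exact (h.preimage Subtype.val_injective.injOn).subset fun e he k _ => he k

/-- Conjugate symmetry makes the support of `w` stable under negation, so its indicator, and the
pointwise inverse extended by `1`, stay in `conjSymm n`. -/
lemma exists_support_idempotent {n : ℕ} (w : conjSymm n) :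
    ∃ e ∈ indicators n, e * e = e ∧ e * w = w ∧ IsUnit (w + (1 - e)) := by
  have h0 (k : ZMod n) : w.1 (-k) = 0 ↔ w.1 k = 0 := by simp [w.2 k]
  let e : conjSymm n := ⟨fun k => if w.1 k = 0 then 0 else 1, fun k => by
    by_cases h : w.1 k = 0 <;> simp [h0, h]⟩
  let v : conjSymm n := ⟨fun k => if w.1 k = 0 then 1 else (w.1 k)⁻¹, fun k => by
    by_cases h : w.1 k = 0
    · simp [h0, h]
    · simp [h, w.2 k]⟩
  refine ⟨e, fun k => ?_, ?_, ?_, IsUnit.of_mul_eq_one v ?_⟩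
  · by_cases h : w.1 k = 0 <;> simp [e, h]
  all_goals
    ext k
    by_cases h : w.1 k = 0 <;> simp [e, v, h]

lemma dft_ofReal_mem (u : ZMod n → ℝ) : ZMod.dft (fun k => (u k : ℂ)) ∈ conjSymm n := by
  intro k
  simp [ZMod.dft_apply, ← AddChar.map_neg_eq_conj]

/-- Reindexing by `j ↦ -j` shows that the inverse transform is real, which makes `realDFT`
surjective. -/
lemma conj_invDFT (f : conjSymm n) (k : ZMod n) :
    starRingEnd ℂ (ZMod.dft.symm f.1 k) = ZMod.dft.symm f.1 k := by
  simp only [ZMod.invDFT_apply, smul_eq_mul, map_mul, map_inv₀, map_natCast, map_sum,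
    ← AddChar.map_neg_eq_conj]
  congr 1
  refine Fintype.sum_equiv (Equiv.neg _) _ _ fun j => ?_
  rw [Equiv.neg_apply, f.2 j, neg_mul]

/-- The discrete Fourier transform of real functions. -/
noncomputable def realDFT (n : ℕ) [NeZero n] : (ZMod n → ℝ) ≃ₗ[ℝ] conjSymm n where
  toFun u := ⟨ZMod.dft fun k => (u k : ℂ), dft_ofReal_mem u⟩
  map_add' u v := by
    ext1
    funext k
    simp [ZMod.dft_apply, mul_add, Finset.sum_add_distrib]
  map_smul' r u := by
    ext1
    funext k
    simp [ZMod.dft_apply, Finset.mul_sum, mul_left_comm]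
  invFun f k := (ZMod.dft.symm f.1 k).re
  left_inv u := by simp
  right_inv f := by
    ext1
    have h : (fun k => ((ZMod.dft.symm f.1 k).re : ℂ)) = ZMod.dft.symm f.1 :=
      funext fun k => Complex.conj_eq_iff_re.mp (conj_invDFT f k)
    simp [h]

lemma realDFT_conv (u v : ZMod n → ℝ) :
    realDFT n (fun k => ∑ j, u j * v (k - j)) = realDFT n u * realDFT n v := by
  ext k
  simp only [realDFT, LinearEquiv.coe_mk, LinearMap.coe_mk, AddHom.coe_mk, MulMemClass.mk_mul_mk,
    Pi.mul_apply, ZMod.dft_apply, smul_eq_mul, Complex.ofReal_sum, Complex.ofReal_mul,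
    Finset.mul_sum, Finset.sum_mul]
  rw [Finset.sum_comm]
  conv_rhs => rw [Finset.sum_comm]
  refine Finset.sum_congr rfl fun j _ => Fintype.sum_equiv (Equiv.subRight j) _ _ fun i => ?_
  have h : -(i * k) = -(j * k) + -((i - j) * k) := by ring
  rw [Equiv.subRight_apply, h, AddChar.map_add_eq_mul]
  ring

end DFT

/-! ### Separation of outer products -/

/-- Vectors of equal outer product, one of them given by nonzero vectors, agree up to scaling. -/
lemma exists_smul_of_mul_eq {ι κ : Type*} {x x₀ : ι → ℝ} {y y₀ : κ → ℝ} (hx₀ : x₀ ≠ 0)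
    (hy₀ : y₀ ≠ 0) (h : ∀ i j, x i * y j = x₀ i * y₀ j) :
    ∃ σ : ℝ, σ ≠ 0 ∧ x = σ • x₀ ∧ y = σ⁻¹ • y₀ := by
  obtain ⟨i, hi⟩ := Function.ne_iff.mp hx₀
  obtain ⟨j, hj⟩ := Function.ne_iff.mp hy₀
  simp only [Pi.zero_apply] at hi hj
  have hij : x i * y j ≠ 0 := by rw [h]; exact mul_ne_zero hi hj
  have hxi := left_ne_zero_of_mul hij
  have hyj := right_ne_zero_of_mul hij
  refine ⟨x i / x₀ i, div_ne_zero hxi hi, funext fun k => ?_, funext fun l => ?_⟩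
  · simp only [Pi.smul_apply, smul_eq_mul]
    field_simp
    apply mul_right_cancel₀ (mul_ne_zero hyj hj)
    linear_combination x₀ i * y₀ j * h k j - x₀ k * y₀ j * h i j
  · simp only [Pi.smul_apply, smul_eq_mul]
    field_simp
    linear_combination h i l

variable {m₁ m₂ : ℕ}

/-- For a family of pairs of pairs with fewer than `n` parameters, almost all `(D, E)` separate the
outer products, provided that circular convolution is the product of a commutative algebra `A` in
which every element has its support among finitely many idempotents. -/
lemma ae_outer_eq_of_circConv_eq_of_equiv {n : ℕ} {A : Type*} [NormedCommRing A]
    [NormedAlgebra ℝ A] (Φ : (Fin n → ℝ) ≃ₗ[ℝ] A) (hΦ : ∀ u v, Φ (circConv u v) = Φ u * Φ v)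
    {I : Set A} (hI : I.Countable)
    (hA : ∀ w : A, ∃ e ∈ I, e * e = e ∧ e * w = w ∧ IsUnit (w + (1 - e)))
    {Q : Type*} [NormedAddCommGroup Q] [NormedSpace ℝ Q]
    [FiniteDimensional ℝ Q] (hQ : Module.finrank ℝ Q < n)
    {x x₀ : Q → Fin m₁ → ℝ} {y y₀ : Q → Fin m₂ → ℝ}
    (hx : Differentiable ℝ x) (hx₀ : Differentiable ℝ x₀)
    (hy : Differentiable ℝ y) (hy₀ : Differentiable ℝ y₀) :
    ∀ᵐ DE : (Fin n → Fin m₁ → ℝ) × (Fin n → Fin m₂ → ℝ) ∂volume, ∀ q,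
      circConv ((Matrix.of DE.1).mulVec (x q)) ((Matrix.of DE.2).mulVec (y q)) =
        circConv ((Matrix.of DE.1).mulVec (x₀ q)) ((Matrix.of DE.2).mulVec (y₀ q)) →
      ∀ i j, x q i * y q j = x₀ q i * y₀ q j := by
  have hfin : FiniteDimensional ℝ A := Φ.finiteDimensional
  have hrank : Module.finrank ℝ A = n := by
    rw [← Φ.finrank_eq, Module.finrank_fin_fun]
  -- Assembles real matrices from columns given by their images in `A`.
  let L : (Fin m₁ → A) × (Fin m₂ → A) →ₗ[ℝ]
      (Fin n → Fin m₁ → ℝ) × (Fin n → Fin m₂ → ℝ) :=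
    { toFun := fun ab => (fun k i => Φ.symm (ab.1 i) k, fun k j => Φ.symm (ab.2 j) k)
      map_add' := fun a b => by ext <;> simp
      map_smul' := fun r a => by ext <;> simp }
  let M : Q → Fin m₁ → Fin m₂ → ℝ := fun q i j => x q i * y q j - x₀ q i * y₀ q j
  have hM (i j) : Differentiable ℝ fun q => M q i j :=
    ((differentiable_pi.mp hx i).mul (differentiable_pi.mp hy j)).sub
      ((differentiable_pi.mp hx₀ i).mul (differentiable_pi.mp hy₀ j))
  have hvol (m : ℕ) : (volume : Measure (Fin n → Fin m → ℝ)).IsAddHaarMeasure :=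
    Measure.pi.isAddHaarMeasure _
  have hvol' : (volume : Measure ((Fin n → Fin m₁ → ℝ) × (Fin n → Fin m₂ → ℝ))).IsAddHaarMeasure :=
    Measure.prod.instIsAddHaarMeasure volume volume
  have hnull := addHaar_image_bilinear_zero_set
    (volume : Measure ((Fin n → Fin m₁ → ℝ) × (Fin n → Fin m₂ → ℝ))) L
    (by simp [Module.finrank_pi_fintype, hrank, mul_comm]) (by rwa [hrank]) M hM
    hI hA
  refine measure_mono_null (fun DE hDE => ?_) hnull
  simp only [Set.mem_compl_iff, Set.mem_ofPred_eq, not_forall] at hDE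
  obtain ⟨q, heq, i, j, hij⟩ := hDE
  let a : Fin m₁ → A := fun i => Φ fun k => DE.1 k i
  let b : Fin m₂ → A := fun j => Φ fun k => DE.2 k j
  have ha (z : Fin m₁ → ℝ) : Φ ((Matrix.of DE.1).mulVec z) = ∑ i, z i • a i := by
    simp only [a, ← map_smul, ← map_sum]
    congr 1
    ext k
    simp [Matrix.mulVec, dotProduct, mul_comm]
  have hb (z : Fin m₂ → ℝ) : Φ ((Matrix.of DE.2).mulVec z) = ∑ j, z j • b j := by
    simp only [b, ← map_smul, ← map_sum]
    congr 1
    ext k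
    simp [Matrix.mulVec, dotProduct, mul_comm]
  have hab (z : Fin m₁ → ℝ) (w : Fin m₂ → ℝ) :
      Φ (circConv ((Matrix.of DE.1).mulVec z) ((Matrix.of DE.2).mulVec w)) =
        ∑ i, a i * ∑ j, (z i * w j) • b j := by
    simp only [hΦ, ha, hb, Finset.sum_mul, mul_smul, ← Finset.smul_sum, mul_smul_comm,
      smul_mul_assoc]
  refine ⟨(a, b), ⟨q, fun h => hij ?_, ?_⟩, ?_⟩
  · exact sub_eq_zero.mp (congrFun (congrFun h i) j)
  · have h := congrArg Φ heq
    rw [hab, hab] at h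
    simp only [M, sub_smul, Finset.sum_sub_distrib, mul_sub]
    exact sub_eq_zero.mpr h
  · ext <;> simp [L, a, b]

lemma ae_outer_eq_of_circConv_eq {n : ℕ} {Q : Type*} [NormedAddCommGroup Q] [NormedSpace ℝ Q]
    [FiniteDimensional ℝ Q] (hQ : Module.finrank ℝ Q < n)
    {x x₀ : Q → Fin m₁ → ℝ} {y y₀ : Q → Fin m₂ → ℝ}
    (hx : Differentiable ℝ x) (hx₀ : Differentiable ℝ x₀)
    (hy : Differentiable ℝ y) (hy₀ : Differentiable ℝ y₀) :
    ∀ᵐ DE : (Fin n → Fin m₁ → ℝ) × (Fin n → Fin m₂ → ℝ) ∂volume, ∀ q,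
      circConv ((Matrix.of DE.1).mulVec (x q)) ((Matrix.of DE.2).mulVec (y q)) =
        circConv ((Matrix.of DE.1).mulVec (x₀ q)) ((Matrix.of DE.2).mulVec (y₀ q)) →
      ∀ i j, x q i * y q j = x₀ q i * y₀ q j := by
  -- `hQ` excludes `n = 0`; otherwise `ZMod (n + 1)` is `Fin (n + 1)` by definition.
  obtain _ | n := n
  · omega
  · exact ae_outer_eq_of_circConv_eq_of_equiv (realDFT (n + 1))
      (realDFT_conv (n := n + 1))
      finite_indicators.countable exists_support_idempotent hQ hx hx₀ hy hy₀

/-! ### Constraint sets as finite unions of subspaces -/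

/-- A set is covered by finitely many subspaces of dimension at most `s`. -/
def CoveredBySubspaces {m : ℕ} (s : ℕ) (X : Set (Fin m → ℝ)) : Prop :=
  ∃ 𝒱 : Set (Submodule ℝ (Fin m → ℝ)), 𝒱.Finite ∧ (∀ V ∈ 𝒱, Module.finrank ℝ V ≤ s) ∧
    ∀ x ∈ X, ∃ V ∈ 𝒱, x ∈ V

lemma coveredBySubspaces_univ (m : ℕ) : CoveredBySubspaces m (Set.univ : Set (Fin m → ℝ)) :=
  ⟨{⊤}, Set.finite_singleton _, by simp, by simp⟩

/-- There is one coordinate subspace for each possible support. -/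
lemma coveredBySubspaces_sparseVectors (m s : ℕ) : CoveredBySubspaces s (sparseVectors m s) := by
  classical
  let V (T : Finset (Fin m)) : Submodule ℝ (Fin m → ℝ) :=
    Submodule.span ℝ (T.image fun i => Pi.single i (1 : ℝ) : Finset (Fin m → ℝ))
  refine ⟨V '' {T | T.card ≤ s}, Set.toFinite _, ?_, fun x hx => ?_⟩
  · rintro _ ⟨T, hT, rfl⟩
    exact (finrank_span_finset_le_card _).trans (Finset.card_image_le.trans hT)
  · refine ⟨_, ⟨Finset.univ.filter fun i => x i ≠ 0, hx, rfl⟩, ?_⟩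
    suffices h : ∑ i, x i • Pi.single i (1 : ℝ) ∈ V (Finset.univ.filter fun i => x i ≠ 0) by
      simpa only [← pi_eq_sum_univ' x] using h
    refine Submodule.sum_mem _ fun i _ => ?_
    by_cases hi : x i = 0
    · simp [hi]
    · exact Submodule.smul_mem _ _ (Submodule.subset_span (by
        simp only [Finset.coe_image, Set.mem_image]
        exact ⟨i, by simpa using hi, rfl⟩))

lemma Scenario.exists_covers (m₁ m₂ : ℕ) (S : Scenario) : ∃ a b, a + b = S.d m₁ m₂ ∧
    CoveredBySubspaces a (S.setX m₁) ∧ CoveredBySubspaces b (S.setY m₂) := by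
  cases S with
  | subspace => exact ⟨_, _, rfl, coveredBySubspaces_univ _, coveredBySubspaces_univ _⟩
  | mixed s₁ => exact ⟨_, _, rfl, coveredBySubspaces_sparseVectors _ _, coveredBySubspaces_univ _⟩
  | sparsity s₁ s₂ =>
    exact ⟨_, _, rfl, coveredBySubspaces_sparseVectors _ _, coveredBySubspaces_sparseVectors _ _⟩

variable {n m₁ m₂ a b : ℕ} {X : Set (Fin m₁ → ℝ)} {Y : Set (Fin m₂ → ℝ)}

/-- The weak separation property for a pair of subspaces. -/
lemma ae_outer_eq_of_mem (V : Submodule ℝ (Fin m₁ → ℝ)) (W : Submodule ℝ (Fin m₂ → ℝ))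
    (h : Module.finrank ℝ V + Module.finrank ℝ W < n) (x₀ : Fin m₁ → ℝ) (y₀ : Fin m₂ → ℝ) :
    ∀ᵐ DE : (Fin n → Fin m₁ → ℝ) × (Fin n → Fin m₂ → ℝ) ∂volume, ∀ x ∈ V, ∀ y ∈ W,
      circConv ((Matrix.of DE.1).mulVec x) ((Matrix.of DE.2).mulVec y) =
        circConv ((Matrix.of DE.1).mulVec x₀) ((Matrix.of DE.2).mulVec y₀) →
      ∀ i j, x i * y j = x₀ i * y₀ j := by
  have hQ : Module.finrank ℝ (V × W) < n := by rwa [Module.finrank_prod]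
  have hx : Differentiable ℝ fun q : V × W => (q.1 : Fin m₁ → ℝ) :=
    V.subtypeL.differentiable.comp differentiable_fst
  have hy : Differentiable ℝ fun q : V × W => (q.2 : Fin m₂ → ℝ) :=
    W.subtypeL.differentiable.comp differentiable_snd
  filter_upwards [ae_outer_eq_of_circConv_eq hQ hx (differentiable_const x₀) hy
    (differentiable_const y₀)] with DE hDE x hx y hy
  exact hDE (⟨x, hx⟩, ⟨y, hy⟩)

/-- The strong separation property for two pairs of subspaces. -/
lemma ae_outer_eq_of_mem_of_mem (V V' : Submodule ℝ (Fin m₁ → ℝ)) (W W' : Submodule ℝ (Fin m₂ → ℝ))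
    (h : Module.finrank ℝ V + Module.finrank ℝ W +
      (Module.finrank ℝ V' + Module.finrank ℝ W') < n) :
    ∀ᵐ DE : (Fin n → Fin m₁ → ℝ) × (Fin n → Fin m₂ → ℝ) ∂volume,
      ∀ x ∈ V, ∀ y ∈ W, ∀ x₀ ∈ V', ∀ y₀ ∈ W',
      circConv ((Matrix.of DE.1).mulVec x) ((Matrix.of DE.2).mulVec y) =
        circConv ((Matrix.of DE.1).mulVec x₀) ((Matrix.of DE.2).mulVec y₀) →
      ∀ i j, x i * y j = x₀ i * y₀ j := by
  let Q := (V × W) × (V' × W')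
  have hQ : Module.finrank ℝ Q < n := by
    rwa [Module.finrank_prod, Module.finrank_prod, Module.finrank_prod]
  have hx : Differentiable ℝ fun q : Q => (q.1.1 : Fin m₁ → ℝ) :=
    V.subtypeL.differentiable.comp differentiable_fst.fst
  have hy : Differentiable ℝ fun q : Q => (q.1.2 : Fin m₂ → ℝ) :=
    W.subtypeL.differentiable.comp differentiable_fst.snd
  have hx₀ : Differentiable ℝ fun q : Q => (q.2.1 : Fin m₁ → ℝ) :=
    V'.subtypeL.differentiable.comp differentiable_snd.fst
  have hy₀ : Differentiable ℝ fun q : Q => (q.2.2 : Fin m₂ → ℝ) :=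
    W'.subtypeL.differentiable.comp differentiable_snd.snd
  filter_upwards [ae_outer_eq_of_circConv_eq hQ hx hx₀ hy hy₀] with DE hDE x hx y hy x₀ hx₀ y₀ hy₀
  exact hDE ((⟨x, hx⟩, ⟨y, hy⟩), (⟨x₀, hx₀⟩, ⟨y₀, hy₀⟩))

/-! ### Weak and strong identifiability -/

/-- The null set may depend on `(x₀, y₀)`, so only `x` and `y` count as parameters. -/
theorem ae_pairIdentifiable (hX : CoveredBySubspaces a X) (hY : CoveredBySubspaces b Y)
    (h : a + b < n) {x₀ : Fin m₁ → ℝ} {y₀ : Fin m₂ → ℝ} (hx₀ : x₀ ≠ 0) (hy₀ : y₀ ≠ 0) :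
    ∀ᵐ DE : (Fin n → Fin m₁ → ℝ) × (Fin n → Fin m₂ → ℝ) ∂volume,
      PairIdentifiable (Matrix.of DE.1) (Matrix.of DE.2) X Y x₀ y₀ := by
  obtain ⟨𝒱, h𝒱, hV, hX⟩ := hX
  obtain ⟨𝒲, h𝒲, hW, hY⟩ := hY
  have key := (ae_ball_iff h𝒱.countable).mpr fun V hV' =>
    (ae_ball_iff h𝒲.countable).mpr fun W hW' =>
      ae_outer_eq_of_mem V W ((add_le_add (hV V hV') (hW W hW')).trans_lt h) x₀ y₀
  filter_upwards [key] with DE hDE x hx y hy heq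
  obtain ⟨V, hV, hxV⟩ := hX x hx
  obtain ⟨W, hW, hyW⟩ := hY y hy
  exact exists_smul_of_mul_eq hx₀ hy₀ (hDE V hV W hW x hxV y hyW heq)

/-- One null set must serve all `(x₀, y₀)`, so these become parameters too; this is the source of
the factor `2`. -/
theorem ae_setIdentifiable (hX : CoveredBySubspaces a X) (hY : CoveredBySubspaces b Y)
    (h : 2 * (a + b) < n) :
    ∀ᵐ DE : (Fin n → Fin m₁ → ℝ) × (Fin n → Fin m₂ → ℝ) ∂volume,
      SetIdentifiable (Matrix.of DE.1) (Matrix.of DE.2) X Y := by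
  obtain ⟨𝒱, h𝒱, hV, hX⟩ := hX
  obtain ⟨𝒲, h𝒲, hW, hY⟩ := hY
  have key := (ae_ball_iff h𝒱.countable).mpr fun V hV₁ =>
    (ae_ball_iff h𝒲.countable).mpr fun W hW₁ =>
    (ae_ball_iff h𝒱.countable).mpr fun V' hV₂ =>
    (ae_ball_iff h𝒲.countable).mpr fun W' hW₂ =>
      ae_outer_eq_of_mem_of_mem (n := n) V V' W W' (by
        have := hV V hV₁; have := hW W hW₁; have := hV V' hV₂; have := hW W' hW₂; omega)
  filter_upwards [key] with DE hDE x₀ hx₀ y₀ hy₀ hx₀' hy₀' x hx y hy heq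
  obtain ⟨V, hV, hxV⟩ := hX x hx
  obtain ⟨W, hW, hyW⟩ := hY y hy
  obtain ⟨V', hV', hxV'⟩ := hX x₀ hx₀
  obtain ⟨W', hW', hyW'⟩ := hY y₀ hy₀
  exact exists_smul_of_mul_eq hx₀' hy₀'
    (hDE V hV W hW V' hV' W' hW' x hxV y hyW x₀ hxV' y₀ hyW' heq)

end BlindDeconv

theorem theorem3 (n m₁ m₂ : ℕ) (S : BlindDeconv.Scenario) :
    (S.d m₁ m₂ < n →
      ∀ x₀ ∈ S.setX m₁, ∀ y₀ ∈ S.setY m₂, x₀ ≠ 0 → y₀ ≠ 0 →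
        ∀ᵐ DE : (Fin n → Fin m₁ → ℝ) × (Fin n → Fin m₂ → ℝ) ∂volume,
          BlindDeconv.PairIdentifiable (Matrix.of DE.1) (Matrix.of DE.2)
            (S.setX m₁) (S.setY m₂) x₀ y₀) ∧
    (2 * S.d m₁ m₂ < n →
      ∀ᵐ DE : (Fin n → Fin m₁ → ℝ) × (Fin n → Fin m₂ → ℝ) ∂volume,
        BlindDeconv.SetIdentifiable (Matrix.of DE.1) (Matrix.of DE.2)
          (S.setX m₁) (S.setY m₂)) := by
  obtain ⟨a, b, hd, hX, hY⟩ := S.exists_covers m₁ m₂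
  rw [← hd]
  exact ⟨fun h x₀ _ y₀ _ hx₀ hy₀ => BlindDeconv.ae_pairIdentifiable hX hY h hx₀ hy₀,
    fun h => BlindDeconv.ae_setIdentifiable hX hY h⟩
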